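/- Let $\mathbf{k}$ be a field of characteristic $0$. For $n\ge 0$ let $\mathfrak{t}_n$ be the $\mathbf{k}$-Lie algebra of infinitesimal braids, presented by generators $t_{ij}$ ($i\neq j\in\{1,\dots,n\}$) and relations $t_{ji}=t_{ij}$, $[t_{ij},t_{ik}+t_{jk}]=0$ for $i,j,k$ distinct, and $[t_{ij},t_{kl}]=0$ for $i,j,k,l$ distinct. A partially defined map $\phi$ from $\{1,\dots,m\}$ to $\{1,\dots,n\}$ induces a Lie algebra morphism $\mathfrak{t}_n\to\mathfrak{t}_m$, $x\mapsto x^{\phi}=x^{\phi^{-1}(1),\dots,\phi^{-1}(n)}$, determined by $t_{ab}^{\phi}=\sum_{a'\in\phi^{-1}(a),\,b'\in\phi^{-1}(b)}t_{a'b'}$. Let $1\le i<j\le n$. If $x\in\mathfrak{t}_n$ satisfies $[x,t_{ij}]=0$, then there exist $\lambda\in\mathbf{k}$ and $y\in\mathfrak{t}_{n-1}$ such that $$x=\lambda\, t_{ij}+y^{\,ij,1,2,\dots,\hat{\imath},\dots,\hat{\jmath},\dots,n},$$ where the superscript stands for the map $\{1,\dots,n\}\to\{1,\dots,n-1\}$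 whose fibres are, in order, $\{i,j\}$ and then the singletons $\{1\},\{2\},\dots,\{n\}$ with $\{i\}$ and $\{j\}$ omitted. -/

import Mathlib

noncomputable section

namespace InfBraid

/-- The index set of the generators `t_{ij}`, `i ≠ j`. -/
abbrev Gen (n : ℕ) : Type := {p : Fin n × Fin n // p.1 ≠ p.2}

/-- The free generator attached to the pair `(i, j)`, `i ≠ j`. -/
def gen (k : Type*) [Field k] {n : ℕ} (i j : Fin n) (h : i ≠ j) : FreeLieAlgebra k (Gen n) :=
  FreeLieAlgebra.of k ⟨(i, j), h⟩

/-- The defining relators of the Lie algebra of infinitesimal braids. -/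
inductive Relator (k : Type*) [Field k] (n : ℕ) : FreeLieAlgebra k (Gen n) → Prop
  | symm (i j : Fin n) (h : i ≠ j) :
      Relator k n (gen k j i h.symm - gen k i j h)
  | triple (i j l : Fin n) (hij : i ≠ j) (hil : i ≠ l) (hjl : j ≠ l) :
      Relator k n ⁅gen k i j hij, gen k i l hil + gen k j l hjl⁆
  | quadruple (i j l m : Fin n) (hij : i ≠ j) (hlm : l ≠ m)
      (hil : i ≠ l) (him : i ≠ m) (hjl : j ≠ l) (hjm : j ≠ m) :
      Relator k n ⁅gen k i j hij, gen k l m hlm⁆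

/-- The Lie ideal generated by the relators. -/
def relIdeal (k : Type*) [Field k] (n : ℕ) : LieIdeal k (FreeLieAlgebra k (Gen n)) :=
  LieSubmodule.lieSpan k (FreeLieAlgebra k (Gen n)) {r | Relator k n r}

end InfBraid

/-- The Lie algebra `𝔱_n` of infinitesimal braids on `n` strands over `k`. The strands are indexed
by `Fin n`. -/
abbrev InfBraid (k : Type*) [Field k] (n : ℕ) : Type _ :=
  FreeLieAlgebra k (InfBraid.Gen n) ⧸ InfBraid.relIdeal k n

namespace InfBraid

section Basic

variable (k : Type*) [Field k] {n : ℕ}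

/-- The quotient morphism from the free Lie algebra to `𝔱_n`. -/
def proj (n : ℕ) : FreeLieAlgebra k (Gen n) →ₗ⁅k⁆ InfBraid k n :=
  { (LieSubmodule.Quotient.mk' (relIdeal k n) :
      FreeLieAlgebra k (Gen n) →ₗ[k] FreeLieAlgebra k (Gen n) ⧸ relIdeal k n) with
    map_lie' := fun {x y} => LieSubmodule.Quotient.mk_bracket (relIdeal k n) x y }

/-- The generator `t_{ij}` of `𝔱_n` for `i ≠ j`. The value at `i = j`, where the generator is not
defined, is set to be `0`. -/
def t (i j : Fin n) : InfBraid k n :=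
  if h : i ≠ j then proj k n (gen k i j h) else 0

theorem proj_gen (i j : Fin n) (h : i ≠ j) : proj k n (gen k i j h) = t k i j := by
  simp [t, h]

theorem proj_eq_zero {r : FreeLieAlgebra k (Gen n)} (h : Relator k n r) : proj k n r = 0 :=
  (LieSubmodule.Quotient.mk_eq_zero (N := relIdeal k n)).2 (LieSubmodule.subset_lieSpan h)

theorem t_symm (i j : Fin n) : t k j i = t k i j := by
  by_cases h : i = j
  · rw [h]
  · have := proj_eq_zero k (Relator.symm i j h)
    rw [map_sub, proj_gen, proj_gen] at this
    exact sub_eq_zero.1 this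

theorem t_triple (i j l : Fin n) (hij : i ≠ j) (hil : i ≠ l) (hjl : j ≠ l) :
    ⁅t k i j, t k i l + t k j l⁆ = 0 := by
  have := proj_eq_zero k (Relator.triple i j l hij hil hjl)
  rwa [LieHom.map_lie, map_add, proj_gen, proj_gen, proj_gen] at this

theorem t_quadruple (i j l m : Fin n) (hij : i ≠ j) (hlm : l ≠ m)
    (hil : i ≠ l) (him : i ≠ m) (hjl : j ≠ l) (hjm : j ≠ m) :
    ⁅t k i j, t k l m⁆ = 0 := by
  have := proj_eq_zero k (Relator.quadruple i j l m hij hlm hil him hjl hjm)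
  rwa [LieHom.map_lie, proj_gen, proj_gen] at this

end Basic

section Lift

variable {k : Type*} [Field k] {n : ℕ} {L : Type*} [LieRing L] [LieAlgebra k L]

/-- The universal property of the presentation: a family `s i j`, `i ≠ j`, of elements of a Lie
algebra satisfying the defining relations of `𝔱_n` gives a morphism `t_{ij} ↦ s i j`. -/
def lift (s : Fin n → Fin n → L)
    (h : ∀ r, Relator k n r → FreeLieAlgebra.lift k (fun p : Gen n => s p.1.1 p.1.2) r = 0) :
    InfBraid k n →ₗ⁅k⁆ L :=
  let F : FreeLieAlgebra k (Gen n) →ₗ⁅k⁆ L :=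
    FreeLieAlgebra.lift k (fun p : Gen n => s p.1.1 p.1.2)
  have hF : relIdeal k n ≤ F.ker :=
    LieSubmodule.lieSpan_le.2 fun r hr => (LieHom.mem_ker (f := F) (x := r)).2 (h r hr)
  { Submodule.liftQ (relIdeal k n).toSubmodule (F : FreeLieAlgebra k (Gen n) →ₗ[k] L)
      (fun r hr => (LieHom.mem_ker (f := F) (x := r)).1 (hF hr)) with
    map_lie' := by
      rintro ⟨x⟩ ⟨y⟩
      exact LieHom.map_lie F x y }

theorem lift_t (s : Fin n → Fin n → L)
    (h : ∀ r, Relator k n r → FreeLieAlgebra.lift k (fun p : Gen n => s p.1.1 p.1.2) r = 0)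
    (i j : Fin n) (hij : i ≠ j) : lift s h (t k i j) = s i j := by
  rw [← proj_gen k i j hij]
  exact FreeLieAlgebra.lift_of_apply (fun p : Gen n => s p.1.1 p.1.2) ⟨(i, j), hij⟩

end Lift

section Simplicial

variable (k : Type*) [Field k] {m n : ℕ}

/-- The fibre `φ⁻¹(a)` of a partially defined map `φ : [m] ⊃ D_φ → [n]`, encoded as a map to
`Option (Fin n)` with the value `none` outside `D_φ`. -/
def fibre (φ : Fin m → Option (Fin n)) (a : Fin n) : Finset (Fin m) :=
  Finset.univ.filter fun p => φ p = some a

/-- `∑_{i' ∈ φ⁻¹(i), j' ∈ φ⁻¹(j)} t_{i'j'}`. -/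
def fibreSum (φ : Fin m → Option (Fin n)) (i j : Fin n) : InfBraid k m :=
  ∑ p ∈ fibre φ i, ∑ q ∈ fibre φ j, t k p q

theorem fibre_ne {φ : Fin m → Option (Fin n)} {a b : Fin n} (h : a ≠ b) {p q : Fin m}
    (hp : p ∈ fibre φ a) (hq : q ∈ fibre φ b) : p ≠ q := by
  simp only [fibre, Finset.mem_filter, Finset.mem_univ, true_and] at hp hq
  rintro rfl
  exact h (Option.some.inj (hp.symm.trans hq))

theorem fibreSum_symm (φ : Fin m → Option (Fin n)) (i j : Fin n) :
    fibreSum k φ j i = fibreSum k φ i j := by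
  rw [fibreSum, fibreSum, Finset.sum_comm]
  exact Finset.sum_congr rfl fun p _ => Finset.sum_congr rfl fun q _ => t_symm k p q

theorem fibreSum_triple (φ : Fin m → Option (Fin n)) (i j l : Fin n)
    (hij : i ≠ j) (hil : i ≠ l) (hjl : j ≠ l) :
    ⁅fibreSum k φ i j, fibreSum k φ i l + fibreSum k φ j l⁆ = 0 := by
  have key : ∀ p ∈ fibre φ i, ∀ q ∈ fibre φ j,
      ⁅t k p q, fibreSum k φ i l + fibreSum k φ j l⁆ = 0 := by
    intro p hp q hq
    have h1 : ⁅t k p q, fibreSum k φ i l⁆ = ∑ r ∈ fibre φ l, ⁅t k p q, t k p r⁆ := by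
      rw [fibreSum, lie_sum, Finset.sum_eq_single p, lie_sum]
      · intro p' hp' hne
        rw [lie_sum]
        exact Finset.sum_eq_zero fun r hr => t_quadruple k p q p' r (fibre_ne hij hp hq)
          (fibre_ne hil hp' hr) hne.symm (fibre_ne hil hp hr) (fibre_ne hij hp' hq).symm
          (fibre_ne hjl hq hr)
      · exact fun h => absurd hp h
    have h2 : ⁅t k p q, fibreSum k φ j l⁆ = ∑ r ∈ fibre φ l, ⁅t k p q, t k q r⁆ := by
      rw [fibreSum, lie_sum, Finset.sum_eq_single q, lie_sum]
      · intro q' hq' hne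
        rw [lie_sum]
        exact Finset.sum_eq_zero fun r hr => t_quadruple k p q q' r (fibre_ne hij hp hq)
          (fibre_ne hjl hq' hr) (fibre_ne hij hp hq') (fibre_ne hil hp hr) hne.symm
          (fibre_ne hjl hq hr)
      · exact fun h => absurd hq h
    rw [lie_add, h1, h2, ← Finset.sum_add_distrib]
    refine Finset.sum_eq_zero fun r hr => ?_
    rw [← lie_add]
    exact t_triple k p q r (fibre_ne hij hp hq) (fibre_ne hil hp hr) (fibre_ne hjl hq hr)
  rw [fibreSum, sum_lie]
  refine Finset.sum_eq_zero fun p hp => ?_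
  rw [sum_lie]
  exact Finset.sum_eq_zero fun q hq => key p hp q hq

theorem fibreSum_quadruple (φ : Fin m → Option (Fin n)) (i j l r : Fin n)
    (hij : i ≠ j) (hlr : l ≠ r) (hil : i ≠ l) (hir : i ≠ r) (hjl : j ≠ l) (hjr : j ≠ r) :
    ⁅fibreSum k φ i j, fibreSum k φ l r⁆ = 0 := by
  simp only [fibreSum, sum_lie, lie_sum]
  refine Finset.sum_eq_zero fun p hp => Finset.sum_eq_zero fun q hq =>
    Finset.sum_eq_zero fun u hu => Finset.sum_eq_zero fun v hv => ?_
  exact t_quadruple k u v p q (fibre_ne hij hu hv) (fibre_ne hlr hp hq) (fibre_ne hil hu hp)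
    (fibre_ne hir hu hq) (fibre_ne hjl hv hp) (fibre_ne hjr hv hq)

/-- The Lie algebra morphism `𝔱_n → 𝔱_m`, `x ↦ x^φ = x^{φ⁻¹(1), …, φ⁻¹(n)}`, attached to a partially
defined map `φ : [m] ⊃ D_φ → [n]`; it is determined by
`t_{ij} ↦ ∑_{i' ∈ φ⁻¹(i), j' ∈ φ⁻¹(j)} t_{i'j'}`. -/
def pullback (φ : Fin m → Option (Fin n)) : InfBraid k n →ₗ⁅k⁆ InfBraid k m :=
  lift (fibreSum k φ) (by
    rintro _ (⟨i, j, h⟩ | ⟨i, j, l, hij, hil, hjl⟩ | ⟨i, j, l, r, hij, hlr, hil, hir, hjl, hjr⟩)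
    · simp only [gen, map_sub, FreeLieAlgebra.lift_of_apply]
      rw [fibreSum_symm, sub_self]
    · simp only [gen, LieHom.map_lie, map_add, FreeLieAlgebra.lift_of_apply]
      exact fibreSum_triple k φ i j l hij hil hjl
    · simp only [gen, LieHom.map_lie, FreeLieAlgebra.lift_of_apply]
      exact fibreSum_quadruple k φ i j l r hij hlr hil hir hjl hjr)

theorem pullback_t (φ : Fin m → Option (Fin n)) (i j : Fin n) (h : i ≠ j) :
    pullback k φ (t k i j) = ∑ p ∈ fibre φ i, ∑ q ∈ fibre φ j, t k p q :=
  lift_t _ _ i j h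

end Simplicial

/-- For `i < j` in `[n]`, the map `[n] → [n-1]` whose sequence of fibres is
`({i, j}, {1}, …, {n})`, with `i` and `j` omitted from `1, …, n`: it sends `i` and `j` to the first
element and the other elements, in increasing order, to the following ones. -/
def mergeMap {n : ℕ} (i j : Fin n) (hij : i < j) (p : Fin n) : Fin (n - 1) :=
  if h : p = i ∨ p = j then ⟨0, by omega⟩
  else if h₁ : p < i then ⟨p.val + 1, by omega⟩
  else if h₂ : p < j then ⟨p.val, by omega⟩
  else ⟨p.val - 1, by omega⟩

/-- The morphism `𝔱_{n-1} → 𝔱_n`, `y ↦ y^{ij,1,…,n}` (`i` and `j` omitted from `1, …, n`), which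
merges the strands `i < j` into the first strand. -/
def merge (k : Type*) [Field k] {n : ℕ} (i j : Fin n) (hij : i < j) :
    InfBraid k (n - 1) →ₗ⁅k⁆ InfBraid k n :=
  pullback k fun p => some (mergeMap i j hij p)

end InfBraid

end

/-! The proof is an induction on the number of strands. Choose a strand `c` other than `i`, `j`.
Forgetting `c` and reinserting it empty splits `x` as an element of the smaller algebra plus an
element of the ideal spanned by Lie polynomials in the `t_{ca}`. Both summands commute with
`t_{ij}`. The first is handled by induction; the scalar `λ` comes only from the base case, where
`i`, `j` are the only strands.

For the second summand, `𝔱_n` acts on the free associative algebra: `t_{ca}` by left multiplication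
by `X_a`, `t_{ab}` by the derivation `X_a ↦ [X_a, X_b]`, `X_b ↦ [X_b, X_a]` (`action`). A Lie
polynomial in the `t_{ca}` that commutes with `t_{ij}` thus yields a noncommutative polynomial
killed by `D = braidDer i j`. The kernel of `D` involves `X_i`, `X_j` only through `X_i + X_j`
(`mergeEnd_eq_self_of_braidDer_eq_zero`): removing first letters gives a recursion on the degree.
Since the free Lie algebra embeds into the free associative one in characteristic zero
(`toFreeAlgebra_injective`), the Lie polynomial involves `t_{ci}`, `t_{cj}` only through `t_{ci} +
t_{cj}`, hence lies in the image of `merge`. -/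

noncomputable section

attribute [local instance] LieRing.ofAssociativeRing

/-! ### Embedding of the free Lie algebra into the free associative algebra -/

namespace FreeLieAlgebra

variable {k : Type*} [CommRing k] {X : Type*}

/-- A Lie subalgebra of a free Lie algebra containing the generators is everything. -/
theorem mem_of_forall_of_mem (S : LieSubalgebra k (FreeLieAlgebra k X))
    (h : ∀ a, of k a ∈ S) (f : FreeLieAlgebra k X) : f ∈ S := by
  have : S.incl.comp (lift k fun a => (⟨of k a, h a⟩ : S)) = LieHom.id := by
    ext a
    simp
  have h2 := congrArg (fun g : FreeLieAlgebra k X →ₗ⁅k⁆ FreeLieAlgebra k X => g f) this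
  simp only [LieHom.comp_apply, LieHom.id_apply] at h2
  rw [← h2]
  exact Subtype.property _

/-- The canonical morphism from the free Lie algebra to the free associative algebra. -/
def toFreeAlgebra (k : Type*) [CommRing k] (X : Type*) : FreeLieAlgebra k X →ₗ⁅k⁆ FreeAlgebra k X :=
  lift k (FreeAlgebra.ι k)

@[simp] theorem toFreeAlgebra_of (a : X) :
    toFreeAlgebra k X (of k a) = FreeAlgebra.ι k a := lift_of_apply _ _

/-- The action of the free associative algebra on `k × FreeLieAlgebra k X` in which a generator `a`
sends `(c, f)` to `(0, c a + ⁅a, f⁆)`. -/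
def dynkinAction (k : Type*) [CommRing k] (X : Type*) :
    FreeAlgebra k X →ₐ[k] Module.End k (k × FreeLieAlgebra k X) :=
  FreeAlgebra.lift k fun a => LinearMap.prod 0
    (LinearMap.coprod (LinearMap.toSpanSingleton k _ (of k a))
      ((LieAlgebra.ad k _ (of k a) : Module.End k (FreeLieAlgebra k X))))

/-- The Euler operator, obtained from the Dynkin bracketing map. -/
def euler (k : Type*) [CommRing k] (X : Type*) :
    FreeLieAlgebra k X →ₗ[k] FreeLieAlgebra k X :=
  LinearMap.snd k k _ ∘ₗ LinearMap.applyₗ ((1, 0) : k × FreeLieAlgebra k X) ∘ₗ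
    (dynkinAction k X).toLinearMap ∘ₗ (toFreeAlgebra k X : FreeLieAlgebra k X →ₗ[k] FreeAlgebra k X)

theorem euler_apply (f : FreeLieAlgebra k X) :
    euler k X f = (dynkinAction k X (toFreeAlgebra k X f) (1, 0)).2 := rfl

/-- The `k` factor supplies the start of a right-nested bracket. The formula is stable under
commutators, which is what makes `euler` a derivation. -/
theorem dynkinAction_toFreeAlgebra (f : FreeLieAlgebra k X) (c : k) (g : FreeLieAlgebra k X) :
    dynkinAction k X (toFreeAlgebra k X f) (c, g) = (0, c • euler k X f + ⁅f, g⁆) := by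
  revert c g
  let S : LieSubalgebra k (FreeLieAlgebra k X) :=
    { carrier := {f | ∀ c g, dynkinAction k X (toFreeAlgebra k X f) (c, g) =
        (0, c • euler k X f + ⁅f, g⁆)}
      zero_mem' := by
        intro c g
        simp [euler_apply, Prod.zero_eq_mk]
      add_mem' := by
        intro f f' hf hf' c g
        simp only [map_add, LinearMap.add_apply, hf c g, hf' c g, add_lie, smul_add,
          Prod.mk_add_mk, add_zero]
        congr 1
        abel
      smul_mem' := by
        intro d f hf c g
        simp only [map_smul, LinearMap.smul_apply, hf c g, Prod.smul_mk, smul_zero, smul_lie,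
          smul_add, smul_comm d c]
      lie_mem' := by
        intro f f' hf hf' c g
        have key : ∀ c g, dynkinAction k X (toFreeAlgebra k X ⁅f, f'⁆) (c, g) =
            (0, c • (⁅f, euler k X f'⁆ - ⁅f', euler k X f⁆) + ⁅⁅f, f'⁆, g⁆) := by
          intro c g
          rw [LieHom.map_lie, LieRing.of_associative_ring_bracket, map_sub, map_mul, map_mul,
            LinearMap.sub_apply, Module.End.mul_apply, Module.End.mul_apply, hf c g, hf' c g,
            hf, hf', Prod.mk_sub_mk]
          simp only [zero_smul, zero_add, sub_zero, lie_add, lie_smul, smul_sub, lie_lie]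
          congr 1
          abel
        -- Evaluated at `(1, 0)`, `key` itself computes `euler k X ⁅f, f'⁆`.
        rw [key, euler_apply ⁅f, f'⁆, key]
        simp }
  have := mem_of_forall_of_mem S (fun a => by
    intro c g
    simp [euler_apply, dynkinAction]) f
  exact this

theorem euler_lie (f g : FreeLieAlgebra k X) :
    euler k X ⁅f, g⁆ = ⁅euler k X f, g⁆ + ⁅f, euler k X g⁆ := by
  rw [euler_apply, LieHom.map_lie, LieRing.of_associative_ring_bracket, map_sub, map_mul, map_mul,
    LinearMap.sub_apply, Module.End.mul_apply, Module.End.mul_apply,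
    dynkinAction_toFreeAlgebra, dynkinAction_toFreeAlgebra, dynkinAction_toFreeAlgebra,
    dynkinAction_toFreeAlgebra]
  simp only [zero_smul, zero_add, one_smul, lie_zero, add_zero, Prod.mk_sub_mk]
  rw [← lie_skew g (euler k X f)]
  abel

theorem euler_of (a : X) : euler k X (of k a) = of k a := by
  simp [euler_apply, dynkinAction]

/-- The free Lie algebra is the sum of the eigenspaces of the Euler operator for the positive
integers. -/
theorem mem_iSup_eigenspace_euler (f : FreeLieAlgebra k X) :
    f ∈ ⨆ m : ℕ, Module.End.eigenspace (euler k X) ((m + 1 : ℕ) : k) := by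
  let S : LieSubalgebra k (FreeLieAlgebra k X) :=
    { (⨆ m : ℕ, Module.End.eigenspace (euler k X) ((m + 1 : ℕ) : k)) with
      lie_mem' := by
        intro f g hf hg
        change f ∈ (⨆ m : ℕ, Module.End.eigenspace (euler k X) ((m + 1 : ℕ) : k)) at hf
        change g ∈ (⨆ m : ℕ, Module.End.eigenspace (euler k X) ((m + 1 : ℕ) : k)) at hg
        change ⁅f, g⁆ ∈ (⨆ m : ℕ, Module.End.eigenspace (euler k X) ((m + 1 : ℕ) : k))
        induction hf using Submodule.iSup_induction' with
        | zero => simp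
        | add f f' _ _ h h' => rw [add_lie]; exact add_mem h h'
        | mem m f hf =>
          induction hg using Submodule.iSup_induction' with
          | zero => simp
          | add g g' _ _ h h' => rw [lie_add]; exact add_mem h h'
          | mem l g hg =>
            refine Submodule.mem_iSup_of_mem (m + l + 1) ?_
            rw [Module.End.mem_eigenspace_iff] at *
            rw [euler_lie, hf, hg, smul_lie, lie_smul, ← add_smul]
            congr 1
            push_cast
            ring }
  refine mem_of_forall_of_mem S (fun a => ?_) f
  refine Submodule.mem_iSup_of_mem (p := fun m : ℕ =>
    Module.End.eigenspace (euler k X) ((m + 1 : ℕ) : k)) 0 ?_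
  rw [Module.End.mem_eigenspace_iff, euler_of]
  simp

/-- In characteristic zero, the free Lie algebra embeds into the free associative algebra. -/
theorem toFreeAlgebra_injective (k : Type*) [Field k] [CharZero k] (X : Type*) :
    Function.Injective (toFreeAlgebra k X) := by
  refine (injective_iff_map_eq_zero _).2 fun f hf => ?_
  -- The Euler operator factors through the free associative algebra, so it kills `f`. Its
  -- eigenvalues on the free Lie algebra are the degrees, which are nonzero in characteristic zero.
  have h0 : f ∈ Module.End.eigenspace (euler k X) 0 := by
    rw [Module.End.mem_eigenspace_iff, euler_apply, hf]
    simp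
  refine Submodule.disjoint_def.1 (Module.End.eigenspaces_iSupIndep (euler k X) 0) f h0 ?_
  have hle : (⨆ m : ℕ, Module.End.eigenspace (euler k X) ((m + 1 : ℕ) : k)) ≤
      ⨆ (μ : k) (_ : μ ≠ 0), Module.End.eigenspace (euler k X) μ :=
    iSup_le fun m => le_iSup₂_of_le ((m + 1 : ℕ) : k) (Nat.cast_ne_zero.2 m.succ_ne_zero) le_rfl
  exact hle (mem_iSup_eigenspace_euler f)

end FreeLieAlgebra

/-! ### Derivations and left quotients of the free associative algebra -/

namespace FreeAlgebra

variable {k : Type*} [CommRing k] {X : Type*}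

/-- Induction by left multiplication with generators. -/
theorem induction_ι_mul {P : FreeAlgebra k X → Prop} (one : P 1)
    (ι_mul : ∀ a g, P g → P (ι k a * g)) (add : ∀ g h, P g → P h → P (g + h))
    (smul : ∀ (c : k) g, P g → P (c • g)) (g : FreeAlgebra k X) : P g := by
  suffices h : ∀ h, P h → P (g * h) by simpa using h 1 one
  induction g using FreeAlgebra.induction with
  | grade0 c => intro h hh; rw [← Algebra.smul_def]; exact smul c h hh
  | grade1 a => exact ι_mul a
  | mul a b ha hb => intro h hh; rw [mul_assoc]; exact ha _ (hb h hh)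
  | add a b ha hb => intro h hh; rw [add_mul]; exact add _ _ (ha h hh) (hb h hh)

/-- A linear map vanishes if it kills `1` and its kernel is stable under left multiplication by
generators. -/
theorem linearMap_eq_zero {M : Type*} [AddCommGroup M] [Module k M] (E : FreeAlgebra k X →ₗ[k] M)
    (one : E 1 = 0) (ι_mul : ∀ a g, E g = 0 → E (ι k a * g) = 0) : E = 0 := by
  ext g
  induction g using induction_ι_mul with
  | one => simpa using one
  | ι_mul a g hg => exact ι_mul a g hg
  | add g h hg hh => simp [hg, hh]
  | smul c g hg => simp [hg]

/-- The action on pairs `(g, E g)` of the operator `skew v w`. -/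
def skewAux (v w : X → FreeAlgebra k X) :
    FreeAlgebra k X →ₐ[k] Module.End k (FreeAlgebra k X × FreeAlgebra k X) :=
  lift k fun a => LinearMap.prod (LinearMap.mulLeft k (ι k a) ∘ₗ LinearMap.fst k _ _)
    (LinearMap.coprod (LinearMap.mulLeft k (v a)) (LinearMap.mulLeft k (w a)))

/-- The linear operator `E = skew v w` with `E 1 = 0` and `E (a g) = v a * g + w a * E g` for
generators `a`. -/
def skew (v w : X → FreeAlgebra k X) : FreeAlgebra k X →ₗ[k] FreeAlgebra k X :=
  LinearMap.snd k _ _ ∘ₗ LinearMap.applyₗ ((1, 0) : FreeAlgebra k X × FreeAlgebra k X) ∘ₗ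
    (skewAux v w).toLinearMap

/-- The recursion for `E (a g)` uses both `g` and `E g`; the first component carries `g` along. -/
theorem skewAux_apply (v w : X → FreeAlgebra k X) (g : FreeAlgebra k X) :
    skewAux v w g (1, 0) = (g, skew v w g) := by
  refine Prod.ext (show _ = g from ?_) rfl
  induction g using induction_ι_mul with
  | one => simp
  | ι_mul a g hg =>
    conv_rhs => rw [← hg]
    rw [map_mul, Module.End.mul_apply]
    simp [skewAux]
  | add g h hg hh => simp [hg, hh]
  | smul c g hg => simp [hg]

@[simp] theorem skew_one (v w : X → FreeAlgebra k X) : skew v w 1 = 0 := by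
  simp [skew]

@[simp] theorem skew_ι_mul (v w : X → FreeAlgebra k X) (a : X) (g : FreeAlgebra k X) :
    skew v w (ι k a * g) = v a * g + w a * skew v w g := by
  have h : skew v w (ι k a * g) = (skewAux v w (ι k a * g) (1, 0)).2 := rfl
  rw [h, map_mul, Module.End.mul_apply, skewAux_apply]
  simp [skewAux]

@[simp] theorem skew_ι (v w : X → FreeAlgebra k X) (a : X) : skew v w (ι k a) = v a := by
  simpa using skew_ι_mul v w a 1

/-- The derivation of the free associative algebra with prescribed values on the generators. -/
def der (v : X → FreeAlgebra k X) : FreeAlgebra k X →ₗ[k] FreeAlgebra k X := skew v (ι k)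

@[simp] theorem der_one (v : X → FreeAlgebra k X) : der v 1 = 0 := skew_one _ _

@[simp] theorem der_ι (v : X → FreeAlgebra k X) (a : X) : der v (ι k a) = v a := skew_ι _ _ _

theorem der_ι_mul (v : X → FreeAlgebra k X) (a : X) (g : FreeAlgebra k X) :
    der v (ι k a * g) = v a * g + ι k a * der v g := skew_ι_mul _ _ _ _

@[simp] theorem der_mul (v : X → FreeAlgebra k X) (g h : FreeAlgebra k X) :
    der v (g * h) = der v g * h + g * der v h := by
  induction g using induction_ι_mul with
  | one => simp
  | ι_mul a g hg => rw [mul_assoc, der_ι_mul, der_ι_mul, hg]; noncomm_ring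
  | add g g' hg hh => simp only [add_mul, map_add, hg, hh]; abel
  | smul c g hg => simp [hg]

/-- Two derivations commute if their commutator vanishes on the generators. -/
theorem der_comm {v v' : X → FreeAlgebra k X} (h : ∀ a, der v (v' a) = der v' (v a)) :
    ⁅(der v : Module.End k (FreeAlgebra k X)), (der v' : Module.End k (FreeAlgebra k X))⁆ = 0 := by
  refine linearMap_eq_zero (k := k) _ ?_ ?_
  · simp [LieRing.of_associative_ring_bracket]
  · intro a g hg
    simp only [LieRing.of_associative_ring_bracket, LinearMap.sub_apply, Module.End.mul_apply,
      der_mul, der_ι, map_add, h a] at hg ⊢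
    rw [sub_eq_zero] at hg
    rw [hg]
    abel

theorem der_mulLeft (v : X → FreeAlgebra k X) (x : FreeAlgebra k X) :
    ⁅(der v : Module.End k (FreeAlgebra k X)),
      (LinearMap.mulLeft k x : Module.End k (FreeAlgebra k X))⁆ = LinearMap.mulLeft k (der v x) := by
  ext g
  simp [LieRing.of_associative_ring_bracket]

theorem der_add (v v' : X → FreeAlgebra k X) : der (v + v') = der v + der v' := by
  refine sub_eq_zero.1 (linearMap_eq_zero _ ?_ ?_)
  · simp
  · intro a g hg
    simp only [LinearMap.sub_apply, LinearMap.add_apply, der_mul, der_ι, Pi.add_apply,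
      sub_eq_zero] at hg ⊢
    rw [hg]
    noncomm_ring

variable [DecidableEq X]

/-- The left quotient by a generator: `leftQuot a (b g)` is `g` if `b = a` and zero otherwise. -/
def leftQuot (a : X) : FreeAlgebra k X →ₗ[k] FreeAlgebra k X :=
  skew (fun b => if b = a then 1 else 0) 0

@[simp] theorem leftQuot_one (a : X) : leftQuot a (1 : FreeAlgebra k X) = 0 := skew_one _ _

theorem leftQuot_ι_mul (a b : X) (g : FreeAlgebra k X) :
    leftQuot a (ι k b * g) = if b = a then g else 0 := by
  simp [leftQuot]

@[simp] theorem leftQuot_ι_mul_self (a : X) (g : FreeAlgebra k X) :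
    leftQuot a (ι k a * g) = g := by
  simp [leftQuot_ι_mul]

theorem leftQuot_ι_mul_of_ne {a b : X} (h : b ≠ a) (g : FreeAlgebra k X) :
    leftQuot a (ι k b * g) = 0 := by
  simp [leftQuot_ι_mul, h]

/-- The submodule of the elements of degree less than `N`. -/
def degLT (k : Type*) [CommRing k] (X : Type*) [DecidableEq X] :
    ℕ → Submodule k (FreeAlgebra k X)
  | 0 => ⊥
  | N + 1 => ⨅ a : X, (degLT k X N).comap (leftQuot a)

theorem mem_degLT_succ {N : ℕ} {g : FreeAlgebra k X} :
    g ∈ degLT k X (N + 1) ↔ ∀ a, leftQuot a g ∈ degLT k X N := by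
  simp [degLT]

theorem degLT_mono : Monotone (degLT k X) := by
  refine monotone_nat_of_le_succ fun N => ?_
  induction N with
  | zero => exact bot_le
  | succ N ih => intro g hg; rw [mem_degLT_succ] at *; exact fun a => ih (hg a)

theorem exists_mem_degLT (g : FreeAlgebra k X) : ∃ N, g ∈ degLT k X N := by
  induction g using induction_ι_mul with
  | one => exact ⟨1, mem_degLT_succ.2 fun a => by simp⟩
  | ι_mul a g hg =>
    obtain ⟨N, hN⟩ := hg
    refine ⟨N + 1, mem_degLT_succ.2 fun b => ?_⟩
    rw [leftQuot_ι_mul]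
    split_ifs
    · exact hN
    · exact zero_mem _
  | add g h hg hh =>
    obtain ⟨N, hN⟩ := hg
    obtain ⟨M, hM⟩ := hh
    exact ⟨max N M, add_mem (degLT_mono (le_max_left _ _) hN) (degLT_mono (le_max_right _ _) hM)⟩
  | smul c g hg =>
    obtain ⟨N, hN⟩ := hg
    exact ⟨N, Submodule.smul_mem _ c hN⟩

/-- A word is either empty or has a unique first letter. -/
theorem eq_algebraMap_add_sum [Fintype X] (g : FreeAlgebra k X) :
    ∃ c : k, g = c • 1 + ∑ a, ι k a * leftQuot a g := by
  induction g using induction_ι_mul with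
  | one => exact ⟨1, by simp⟩
  | ι_mul b g hg => exact ⟨0, by simp [leftQuot_ι_mul]⟩
  | add g h hg hh =>
    obtain ⟨c, hc⟩ := hg
    obtain ⟨d, hd⟩ := hh
    refine ⟨c + d, ?_⟩
    nth_rw 1 [hc, hd]
    simp only [map_add, mul_add, Finset.sum_add_distrib, add_smul]
    abel
  | smul c g hg =>
    obtain ⟨d, hd⟩ := hg
    refine ⟨c * d, ?_⟩
    nth_rw 1 [hd]
    simp [mul_smul, Finset.smul_sum]

end FreeAlgebra

/-! ### The kernel of the derivation `braidDer i j` -/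

namespace FreeAlgebra

variable {k : Type*} [CommRing k] {X : Type*} [DecidableEq X]

/-- The values of `braidDer i j` on the generators. -/
def braidDerVal (i j a : X) : FreeAlgebra k X :=
  if a = i then ι k i * ι k j - ι k j * ι k i
  else if a = j then ι k j * ι k i - ι k i * ι k j else 0

/-- The derivation `X_i ↦ [X_i, X_j]`, `X_j ↦ [X_j, X_i]`, `X_a ↦ 0` for `a ≠ i, j`. -/
def braidDer (i j : X) : FreeAlgebra k X →ₗ[k] FreeAlgebra k X := der (braidDerVal i j)

/-- The algebra endomorphism `X_i ↦ 0`, `X_j ↦ X_i + X_j`, `X_a ↦ X_a` for `a ≠ i, j`. -/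
def mergeEnd (i j : X) : FreeAlgebra k X →ₐ[k] FreeAlgebra k X :=
  lift k fun a => if a = i then 0 else if a = j then ι k i + ι k j else ι k a

variable {i j : X}

/-- With `∂_a` the left quotients, `D = braidDer i j` and `δ = ∂_i - ∂_j`, this identity and the
next express `δ D` and `∂_j D` through `δ` and `∂_j` alone, so that the two can be iterated. -/
theorem leftQuot_sub_braidDer (hij : i ≠ j) (g : FreeAlgebra k X) :
    leftQuot i (braidDer i j g) - leftQuot j (braidDer i j g) =
      braidDer i j (leftQuot i g - leftQuot j g) +
        (ι k i + ι k j) * (leftQuot i g - leftQuot j g) := by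
  induction g using induction_ι_mul with
  | one => simp [braidDer]
  | ι_mul b g hg =>
    -- The product rule exposes the first letters of `D (X_b g)`, so the identity for `g` is not
    -- needed.
    clear hg
    by_cases hbi : b = i
    · subst hbi
      simp [braidDer, braidDerVal, sub_mul, mul_assoc, leftQuot_ι_mul, hij, hij.symm]
      noncomm_ring
    · by_cases hbj : b = j
      · subst hbj
        simp [braidDer, braidDerVal, sub_mul, mul_assoc, leftQuot_ι_mul, hij, hij.symm]
        noncomm_ring
      · simp [braidDer, braidDerVal, leftQuot_ι_mul, hbi, hbj]
  | add g h hg hh =>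
    simp only [map_add, map_sub, mul_add, mul_sub] at *
    rw [add_sub_add_comm, hg, hh]
    abel
  | smul c g hg => simp only [map_smul, ← smul_sub, hg, mul_smul_comm, smul_add]

theorem leftQuot_braidDer (hij : i ≠ j) (g : FreeAlgebra k X) :
    leftQuot j (braidDer i j g) =
      braidDer i j (leftQuot j g) - ι k i * (leftQuot i g - leftQuot j g) := by
  induction g using induction_ι_mul with
  | one => simp [braidDer]
  | ι_mul b g hg =>
    clear hg
    by_cases hbi : b = i
    · subst hbi
      simp [braidDer, braidDerVal, sub_mul, mul_assoc, leftQuot_ι_mul, hij]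
    · by_cases hbj : b = j
      · subst hbj
        simp [braidDer, braidDerVal, sub_mul, mul_assoc, leftQuot_ι_mul, hij, hij.symm]
        abel
      · simp [braidDer, braidDerVal, leftQuot_ι_mul, hbi, hbj]
  | add g h hg hh =>
    simp only [map_add, hg, hh]
    noncomm_ring
  | smul c g hg => simp only [map_smul, ← smul_sub, hg, mul_smul_comm]

theorem leftQuot_braidDer_of_ne (hij : i ≠ j) {a : X} (hai : a ≠ i) (haj : a ≠ j)
    (g : FreeAlgebra k X) :
    leftQuot a (braidDer i j g) = braidDer i j (leftQuot a g) := by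
  induction g using induction_ι_mul with
  | one => simp [braidDer]
  | ι_mul b g hg =>
    clear hg
    by_cases hbi : b = i
    · subst hbi
      simp [braidDer, braidDerVal, sub_mul, mul_assoc, leftQuot_ι_mul, hai.symm, haj.symm]
    · by_cases hbj : b = j
      · subst hbj
        simp [braidDer, braidDerVal, sub_mul, mul_assoc, leftQuot_ι_mul, hij.symm, hai.symm,
          haj.symm]
      · by_cases hba : b = a
        · subst hba
          simp [braidDer, braidDerVal, hbi, hbj]
        · simp [braidDer, braidDerVal, leftQuot_ι_mul, hbi, hbj, hba]
  | add g h hg hh => simp only [map_add, hg, hh]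
  | smul c g hg => simp only [map_smul, hg]

/-- The recursion `D g' = X_i δ g`, `g' = ∂_j g`, where `δ = ∂_i - ∂_j`, forces `δ g = 0`. -/
theorem leftQuot_sub_eq_zero (hij : i ≠ j) {N : ℕ} {g g₀ : FreeAlgebra k X} (hg : g ∈ degLT k X N)
    (h : braidDer i j g = ι k i * g₀) : g₀ = 0 := by
  induction N generalizing g g₀ with
  | zero =>
    have hg' : g = 0 := hg
    rw [hg', map_zero] at h
    rw [← leftQuot_ι_mul_self i g₀, ← h, map_zero]
  | succ N ih =>
    -- Applied to `D g = X_i g₀`, the two identities read `g₀ = D δg + (X_i + X_j) δg` and `D ∂_j g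
    -- = X_i δg`. The latter is the hypothesis again, one degree lower, and gives `δg = 0`.
    have h1 := leftQuot_sub_braidDer hij g
    have h2 := leftQuot_braidDer hij g
    rw [h, leftQuot_ι_mul_self, leftQuot_ι_mul_of_ne hij, sub_zero] at h1
    rw [h, leftQuot_ι_mul_of_ne hij, eq_comm, sub_eq_zero] at h2
    rw [h1, ih (mem_degLT_succ.1 hg j) h2]
    simp

/-- The kernel of `braidDer i j` consists of fixed points of `mergeEnd i j`. -/
theorem mergeEnd_eq_self_of_braidDer_eq_zero (hij : i ≠ j) [Fintype X] {g : FreeAlgebra k X}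
    (h : braidDer i j g = 0) : mergeEnd i j g = g := by
  obtain ⟨N, hN⟩ := exists_mem_degLT g
  induction N generalizing g with
  | zero => rw [show g = 0 from hN, map_zero]
  | succ N ih =>
    rw [mem_degLT_succ] at hN
    have h1 : leftQuot i g - leftQuot j g = 0 := by
      refine leftQuot_sub_eq_zero hij (hN j) ?_
      have := leftQuot_braidDer hij g
      rw [h, map_zero, eq_comm, sub_eq_zero] at this
      exact this
    have h2 : ∀ a, braidDer i j (leftQuot a g) = 0 := by
      have hj : braidDer i j (leftQuot j g) = 0 := by
        have := leftQuot_braidDer hij g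
        rw [h, h1, map_zero, mul_zero, sub_zero] at this
        exact this.symm
      intro a
      by_cases hai : a = i
      · rw [hai, sub_eq_zero.1 h1, hj]
      · by_cases haj : a = j
        · rw [haj, hj]
        · rw [← leftQuot_braidDer_of_ne hij hai haj, h, map_zero]
    have h3 : ∀ a, mergeEnd i j (leftQuot a g) = leftQuot a g := fun a => ih (h2 a) (hN a)
    obtain ⟨c, hc⟩ := eq_algebraMap_add_sum g
    have hsplit : ∀ F : X → FreeAlgebra k X,
        ∑ a, F a = F i + (F j + ∑ a ∈ (Finset.univ.erase i).erase j, F a) := by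
      intro F
      rw [Finset.add_sum_erase _ _ (by simp [hij.symm]), Finset.add_sum_erase _ _ (by simp)]
    rw [hsplit, sub_eq_zero.1 h1] at hc
    have h4 : ∑ a ∈ (Finset.univ.erase i).erase j, mergeEnd i j (ι k a) * leftQuot a g =
        ∑ a ∈ (Finset.univ.erase i).erase j, ι k a * leftQuot a g := by
      refine Finset.sum_congr rfl fun a ha => ?_
      simp only [Finset.mem_erase, Finset.mem_univ, and_true] at ha
      simp [mergeEnd, ha.1, ha.2]
    have hi : mergeEnd (k := k) i j (ι k i) = 0 := by simp [mergeEnd]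
    have hj : mergeEnd (k := k) i j (ι k j) = ι k i + ι k j := by simp [mergeEnd, hij.symm]
    conv_rhs => rw [hc]
    conv_lhs => rw [hc]
    -- As `∂_i g = ∂_j g`, both sides contain `(X_i + X_j) ∂_j g`: on the left it comes entirely
    -- from the image of `X_j`.
    simp only [map_add, map_smul, map_one, map_mul, map_sum, h3, h4, hi, hj]
    noncomm_ring

end FreeAlgebra

/-! ### The action of `𝔱_n` on the free associative algebra -/

namespace InfBraid

open FreeAlgebra (ι braidDer braidDerVal der)

section

variable {k : Type*} [Field k] {n : ℕ}

theorem t_self (i : Fin n) : t k i i = 0 := by simp [t]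

/-- A Lie subalgebra of `𝔱_n` containing the generators is everything. -/
theorem mem_of_forall_t_mem (S : LieSubalgebra k (InfBraid k n))
    (h : ∀ a b, a ≠ b → t k a b ∈ S) (x : InfBraid k n) : x ∈ S := by
  obtain ⟨f, rfl⟩ : ∃ f, proj k n f = x := LieSubmodule.Quotient.surjective_mk' (relIdeal k n) x
  refine FreeLieAlgebra.mem_of_forall_of_mem (S.comap (proj k n)) (fun p => ?_) f
  change proj k n (gen k p.1.1 p.1.2 p.2) ∈ S
  rw [proj_gen]
  exact h _ _ p.2

/-- A family of elements satisfying the defining relations of `𝔱_n` kills all relators. -/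
theorem relator_lift_eq_zero {L : Type*} [LieRing L] [LieAlgebra k L] (s : Fin n → Fin n → L)
    (symm : ∀ i j, i ≠ j → s j i = s i j)
    (triple : ∀ i j l, i ≠ j → i ≠ l → j ≠ l → ⁅s i j, s i l + s j l⁆ = 0)
    (quadruple : ∀ i j l m, i ≠ j → l ≠ m → i ≠ l → i ≠ m → j ≠ l → j ≠ m → ⁅s i j, s l m⁆ = 0) :
    ∀ r, Relator k n r → FreeLieAlgebra.lift k (fun p : Gen n => s p.1.1 p.1.2) r = 0 := by
  rintro _ (⟨i, j, h⟩ | ⟨i, j, l, hij, hil, hjl⟩ | ⟨i, j, l, r, hij, hlr, hil, hir, hjl, hjr⟩)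
  · simp only [gen, map_sub, FreeLieAlgebra.lift_of_apply]
    rw [symm i j h, sub_self]
  · simp only [gen, LieHom.map_lie, map_add, FreeLieAlgebra.lift_of_apply]
    exact triple i j l hij hil hjl
  · simp only [gen, LieHom.map_lie, FreeLieAlgebra.lift_of_apply]
    exact quadruple i j l r hij hlr hil hir hjl hjr

/-- The image `s a b` of `t_{ab}` in the action of `𝔱_n` on the free associative algebra obtained by
singling out the strand `c`. -/
def actionVal (k : Type*) [Field k] {n : ℕ} (c a b : Fin n) :
    Module.End k (FreeAlgebra k (Fin n)) :=
  if a = c then LinearMap.mulLeft k (ι k b)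
  else if b = c then LinearMap.mulLeft k (ι k a) else braidDer a b

theorem braidDerVal_swap {a b : Fin n} (h : a ≠ b) :
    braidDerVal (k := k) b a = braidDerVal a b := by
  funext e
  unfold braidDerVal
  split_ifs <;> simp_all

theorem braidDer_swap {a b : Fin n} (h : a ≠ b) : braidDer (k := k) b a = braidDer a b := by
  rw [braidDer, braidDerVal_swap h, braidDer]

theorem mulLeft_lie_mulLeft (x y : FreeAlgebra k (Fin n)) :
    ⁅(LinearMap.mulLeft k x : Module.End k (FreeAlgebra k (Fin n))),
      (LinearMap.mulLeft k y : Module.End k (FreeAlgebra k (Fin n)))⁆ =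
      LinearMap.mulLeft k (x * y - y * x) := by
  ext g
  simp [LieRing.of_associative_ring_bracket, sub_mul, mul_assoc]

theorem braidDer_lie_mulLeft (a b e : Fin n) :
    ⁅(braidDer a b : Module.End k (FreeAlgebra k (Fin n))),
      (LinearMap.mulLeft k (ι k e) : Module.End k (FreeAlgebra k (Fin n)))⁆ =
      LinearMap.mulLeft k (braidDerVal a b e) := by
  rw [braidDer, FreeAlgebra.der_mulLeft, FreeAlgebra.der_ι]

theorem mulLeft_lie_braidDer (a b e : Fin n) :
    ⁅(LinearMap.mulLeft k (ι k e) : Module.End k (FreeAlgebra k (Fin n))),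
      (braidDer a b : Module.End k (FreeAlgebra k (Fin n)))⁆ =
      - LinearMap.mulLeft k (braidDerVal a b e) := by
  rw [← lie_skew, braidDer_lie_mulLeft]

theorem braidDer_triple {a b e : Fin n} (hab : a ≠ b) (hae : a ≠ e) (hbe : b ≠ e) :
    ⁅(braidDer a b : Module.End k (FreeAlgebra k (Fin n))),
      (braidDer a e + braidDer b e : Module.End k (FreeAlgebra k (Fin n)))⁆ = 0 := by
  rw [braidDer, braidDer, braidDer, ← FreeAlgebra.der_add]
  refine FreeAlgebra.der_comm fun d => ?_
  simp only [FreeAlgebra.der_add, Pi.add_apply, LinearMap.add_apply]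
  by_cases hda : d = a
  · subst hda
    simp [braidDerVal, hab, hae, hab.symm, hae.symm, hbe, hbe.symm]
    noncomm_ring
  · by_cases hdb : d = b
    · subst hdb
      simp [braidDerVal, hab, hae, hab.symm, hae.symm, hbe, hbe.symm]
      noncomm_ring
    · by_cases hde : d = e
      · subst hde
        simp [braidDerVal, hab.symm, hae.symm, hbe.symm]
        noncomm_ring
      · simp [braidDerVal, hda, hdb, hde]

theorem braidDer_quadruple {a b e f : Fin n} (hae : a ≠ e) (haf : a ≠ f) (hbe : b ≠ e)
    (hbf : b ≠ f) :
    ⁅(braidDer a b : Module.End k (FreeAlgebra k (Fin n))),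
      (braidDer e f : Module.End k (FreeAlgebra k (Fin n)))⁆ = 0 := by
  refine FreeAlgebra.der_comm fun d => ?_
  by_cases hd : d = a ∨ d = b
  · have h1 : d ≠ e := by rintro rfl; tauto
    have h2 : d ≠ f := by rintro rfl; tauto
    simp only [braidDerVal, h1, h2, if_false, map_zero]
    split_ifs <;> simp [braidDerVal, hae, haf, hbe, hbf]
  · push Not at hd
    simp only [braidDerVal, hd.1, hd.2, if_false, map_zero]
    split_ifs <;> simp [braidDerVal, hae.symm, haf.symm, hbe.symm, hbf.symm]

/-- The action of `𝔱_n` on the free associative algebra in which `t_{ca}` acts by left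
multiplication by `X_a` and `t_{ab}` by the derivation `braidDer a b`. -/
def action (k : Type*) [Field k] {n : ℕ} (c : Fin n) :
    InfBraid k n →ₗ⁅k⁆ Module.End k (FreeAlgebra k (Fin n)) :=
  lift (actionVal k c) (relator_lift_eq_zero _
    (by
      intro i j hij
      unfold actionVal
      split_ifs with h1 h2 h2
      · exact absurd (h2.trans h1.symm) hij
      · rfl
      · rfl
      · exact braidDer_swap hij)
    (by
      intro i j l hij hil hjl
      unfold actionVal
      -- If `c` is `i` or `j`, the relation expresses the value of the derivation on a generator; if
      -- `c = l`, it says that `braidDer i j` kills `X_i + X_j`.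
      by_cases hi : i = c
      · subst hi
        simp only [if_true, hij.symm, hil.symm, if_false, lie_add, mulLeft_lie_mulLeft,
          mulLeft_lie_braidDer]
        simp [braidDerVal]
      · by_cases hj : j = c
        · subst hj
          simp only [if_true, hij, hjl.symm, if_false, lie_add, mulLeft_lie_mulLeft,
            mulLeft_lie_braidDer]
          simp [braidDerVal]
        · by_cases hl : l = c
          · subst hl
            simp only [if_true, hil, hjl, if_false, lie_add, braidDer_lie_mulLeft]
            ext g
            simp [braidDerVal, hij.symm, sub_mul]
          · simp only [hi, hj, hl, if_false]
            exact braidDer_triple hij hil hjl)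
    (by
      intro i j l m hij hlm hil him hjl hjm
      unfold actionVal
      by_cases hi : i = c
      · subst hi
        simp only [if_true, hij.symm, hil.symm, him.symm, if_false, mulLeft_lie_braidDer]
        ext g
        simp [braidDerVal, hjl, hjm]
      · by_cases hj : j = c
        · subst hj
          simp only [if_true, hij, hjl.symm, hjm.symm, if_false, mulLeft_lie_braidDer]
          ext g
          simp [braidDerVal, hil, him]
        · by_cases hl : l = c
          · subst hl
            simp only [if_true, hi, hj, hlm.symm, if_false, braidDer_lie_mulLeft]
            ext g
            simp [braidDerVal, him.symm, hjm.symm]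
          · by_cases hm : m = c
            · subst hm
              simp only [if_true, hi, hj, hl, if_false, braidDer_lie_mulLeft]
              ext g
              simp [braidDerVal, hil.symm, hjl.symm]
            · simp only [hi, hj, hl, hm, if_false]
              exact braidDer_quadruple hil him hjl hjm))

theorem action_t (c : Fin n) {a b : Fin n} (h : a ≠ b) :
    action k c (t k a b) = actionVal k c a b := lift_t _ _ a b h

/-- The morphism `X_a ↦ t_{ca}`. -/
def strand (k : Type*) [Field k] {n : ℕ} (c : Fin n) :
    FreeLieAlgebra k (Fin n) →ₗ⁅k⁆ InfBraid k n :=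
  FreeLieAlgebra.lift k fun a => t k c a

@[simp] theorem strand_of (c a : Fin n) : strand k c (FreeLieAlgebra.of k a) = t k c a :=
  FreeLieAlgebra.lift_of_apply _ _

/-- The endomorphism of the free Lie algebra killing the generator `c`. -/
def killGen (k : Type*) [Field k] {n : ℕ} (c : Fin n) :
    FreeLieAlgebra k (Fin n) →ₗ⁅k⁆ FreeLieAlgebra k (Fin n) :=
  FreeLieAlgebra.lift k fun a => if a = c then 0 else FreeLieAlgebra.of k a

/-- The endomorphism `X_i ↦ 0`, `X_j ↦ X_i + X_j`, `X_a ↦ X_a` of the free Lie algebra. -/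
def mergeLieEnd (k : Type*) [Field k] {n : ℕ} (i j : Fin n) :
    FreeLieAlgebra k (Fin n) →ₗ⁅k⁆ FreeLieAlgebra k (Fin n) :=
  FreeLieAlgebra.lift k fun a => if a = i then 0
    else if a = j then FreeLieAlgebra.of k i + FreeLieAlgebra.of k j else FreeLieAlgebra.of k a

theorem strand_killGen (c : Fin n) (f : FreeLieAlgebra k (Fin n)) :
    strand k c (killGen k c f) = strand k c f := by
  have : (strand k c).comp (killGen k c) = strand k c := by
    ext a
    by_cases h : a = c
    · simp [killGen, h, t_self]
    · simp [killGen, h]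
  exact congrArg (fun F : FreeLieAlgebra k (Fin n) →ₗ⁅k⁆ InfBraid k n => F f) this

/-- Both sides are Lie morphisms in `f`, so generators suffice. The free algebra keeps a superfluous
variable `X_c`, whereas `t_{cc} = 0`; this is why `killGen` intervenes. -/
theorem action_strand (c : Fin n) (f : FreeLieAlgebra k (Fin n)) :
    action k c (strand k c f) =
      LinearMap.mulLeft k (FreeLieAlgebra.toFreeAlgebra k _ (killGen k c f)) := by
  let S : LieSubalgebra k (FreeLieAlgebra k (Fin n)) :=
    { carrier := {f | action k c (strand k c f) =
        LinearMap.mulLeft k (FreeLieAlgebra.toFreeAlgebra k _ (killGen k c f))}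
      zero_mem' := by
        ext g
        simp
      add_mem' := by
        intro f g hf hg
        ext h
        simp only [Set.mem_ofPred_eq] at hf hg
        simp [hf, hg, add_mul]
      smul_mem' := by
        intro d f hf
        ext h
        simp only [Set.mem_ofPred_eq] at hf
        simp [hf]
      lie_mem' := by
        intro f g hf hg
        simp only [Set.mem_ofPred_eq] at *
        simp only [LieHom.map_lie]
        erw [hf, hg]
        rw [mulLeft_lie_mulLeft, LieRing.of_associative_ring_bracket] }
  refine FreeLieAlgebra.mem_of_forall_of_mem S (fun a => ?_) f
  change action k c (strand k c _) = LinearMap.mulLeft k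
    (FreeLieAlgebra.toFreeAlgebra k _ (killGen k c _))
  by_cases h : a = c
  · subst h
    ext g
    simp [killGen, t_self]
  · rw [strand_of, action_t c (Ne.symm h)]
    simp [killGen, h, actionVal]

theorem toFreeAlgebra_mergeLieEnd (i j : Fin n) (f : FreeLieAlgebra k (Fin n)) :
    FreeLieAlgebra.toFreeAlgebra k _ (mergeLieEnd k i j f) =
      FreeAlgebra.mergeEnd i j (FreeLieAlgebra.toFreeAlgebra k _ f) := by
  have : (FreeLieAlgebra.toFreeAlgebra k _).comp (mergeLieEnd k i j) =
      ((FreeAlgebra.mergeEnd i j : FreeAlgebra k (Fin n) →ₐ[k] _) :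
        FreeAlgebra k (Fin n) →ₗ⁅k⁆ FreeAlgebra k (Fin n)).comp
        (FreeLieAlgebra.toFreeAlgebra k _) := by
    ext a
    by_cases hi : a = i
    · simp [mergeLieEnd, FreeAlgebra.mergeEnd, hi]
    · by_cases hj : a = j
      · subst hj
        simp [mergeLieEnd, FreeAlgebra.mergeEnd, hi]
      · simp [mergeLieEnd, FreeAlgebra.mergeEnd, hi, hj]
  exact congrArg (fun F : FreeLieAlgebra k (Fin n) →ₗ⁅k⁆ FreeAlgebra k (Fin n) => F f) this

/-- An element of the free part of `𝔱_n` at the strand `c` commuting with `t_{ij}` is the image of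
an element of the form `mergeLieEnd k i j f`. -/
theorem exists_strand_mergeLieEnd [CharZero k] {c i j : Fin n} (hij : i ≠ j) (hi : i ≠ c)
    (hj : j ≠ c) (f : FreeLieAlgebra k (Fin n)) (h : ⁅strand k c f, t k i j⁆ = 0) :
    ∃ g, strand k c f = strand k c (mergeLieEnd k i j g) := by
  -- The action sees `f` only through `killGen k c f`, which has the same image under `strand`.
  refine ⟨killGen k c f, ?_⟩
  rw [← strand_killGen]
  congr 1
  refine FreeLieAlgebra.toFreeAlgebra_injective k _ ?_
  rw [toFreeAlgebra_mergeLieEnd]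
  refine (FreeAlgebra.mergeEnd_eq_self_of_braidDer_eq_zero hij ?_).symm
  have h1 := congrArg (action k c) h
  rw [LieHom.map_lie, action_strand, action_t c hij, map_zero] at h1
  -- A derivation kills `1`, so evaluating the commutator at `1` leaves only `braidDer i j` of the
  -- polynomial, up to sign.
  have h2 := congrArg (fun E : Module.End k (FreeAlgebra k (Fin n)) => E 1) h1
  simpa [LieRing.of_associative_ring_bracket, actionVal, hi, hj, braidDer] using h2

end

end InfBraid

/-! ### Splitting off a strand -/

namespace InfBraid

section

variable {k : Type*} [Field k] {n : ℕ}

/-- The image of `t_{ab}` under the insertion of an empty strand at `c`. -/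
def insertVal (k : Type*) [Field k] {n : ℕ} (c : Fin (n + 1)) (a b : Fin n) :
    InfBraid k (n + 1) :=
  t k (c.succAbove a) (c.succAbove b)

theorem insertVal_relator (c : Fin (n + 1)) : ∀ r, Relator k n r →
    FreeLieAlgebra.lift k (fun p : Gen n => insertVal k c p.1.1 p.1.2) r = 0 :=
  have h : ∀ {a b : Fin n}, a ≠ b → c.succAbove a ≠ c.succAbove b :=
    fun hab => Fin.succAbove_right_injective.ne hab
  relator_lift_eq_zero (insertVal k c)
    (fun _ _ _ => t_symm k _ _)
    (fun _ _ _ hij hil hjl => t_triple k _ _ _ (h hij) (h hil) (h hjl))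
    (fun _ _ _ _ hij hlm hil him hjl hjm =>
      t_quadruple k _ _ _ _ (h hij) (h hlm) (h hil) (h him) (h hjl) (h hjm))

/-- The morphism `𝔱_n → 𝔱_{n+1}` inserting an empty strand at `c`. -/
def insertStrand (k : Type*) [Field k] {n : ℕ} (c : Fin (n + 1)) :
    InfBraid k n →ₗ⁅k⁆ InfBraid k (n + 1) :=
  lift (insertVal k c) (insertVal_relator c)

theorem insertStrand_t (c : Fin (n + 1)) (a b : Fin n) :
    insertStrand k c (t k a b) = t k (c.succAbove a) (c.succAbove b) := by
  by_cases h : a = b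
  · subst h
    simp [t_self]
  · exact lift_t (insertVal k c) (insertVal_relator c) a b h

/-- The morphism `𝔱_{n+1} → 𝔱_n` forgetting the strand `c`. -/
def forgetStrand (k : Type*) [Field k] {n : ℕ} (c : Fin (n + 1)) :
    InfBraid k (n + 1) →ₗ⁅k⁆ InfBraid k n :=
  pullback k fun p => some (c.succAbove p)

theorem fibre_some {m : ℕ} {φ : Fin m → Fin n} (hφ : Function.Injective φ) (p : Fin m) :
    fibre (fun q => some (φ q)) (φ p) = {p} := by
  ext q
  simp [fibre, hφ.eq_iff]

theorem forgetStrand_t_succAbove (c : Fin (n + 1)) (a b : Fin n) :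
    forgetStrand k c (t k (c.succAbove a) (c.succAbove b)) = t k a b := by
  by_cases h : a = b
  · subst h
    simp [t_self]
  · rw [forgetStrand, pullback_t _ _ _ _ (by simpa using h),
      fibre_some Fin.succAbove_right_injective, fibre_some Fin.succAbove_right_injective]
    simp

theorem forgetStrand_t_self (c a : Fin (n + 1)) : forgetStrand k c (t k c a) = 0 := by
  by_cases h : c = a
  · subst h
    simp [t_self]
  · rw [forgetStrand, pullback_t _ _ _ _ h]
    have : fibre (fun q => some (c.succAbove q)) c = ∅ := by
      ext q
      simp [fibre, Fin.succAbove_ne]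
    simp [this]

/-- The range is an ideal: for distinct `a`, `b`, `c` the triple relation gives `[t_{ab}, t_{ca}] =
[t_{ca}, t_{cb}]`, and `t_{ab}` commutes with `t_{ce}` when the four indices are distinct. -/
theorem lie_mem_range_strand (c : Fin n) (x y : InfBraid k n) (hy : y ∈ (strand k c).range) :
    ⁅x, y⁆ ∈ (strand k c).range := by
  have ht : ∀ a, t k c a ∈ (strand k c).range := fun a => ⟨_, strand_of c a⟩
  have hgen : ∀ a b e : Fin n, a ≠ b → ⁅t k a b, t k c e⁆ ∈ (strand k c).range := by
    intro a b e hab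
    by_cases hac : a = c
    · subst hac
      exact LieSubalgebra.lie_mem _ (ht b) (ht e)
    by_cases hbc : b = c
    · subst hbc
      rw [t_symm]
      exact LieSubalgebra.lie_mem _ (ht a) (ht e)
    by_cases hce : c = e
    · subst hce
      simp [t_self]
    have key : ∀ a b : Fin n, a ≠ b → a ≠ c → b ≠ c → ⁅t k a b, t k c a⁆ ∈ (strand k c).range := by
      intro a b hab hac hbc
      have := t_triple k c a b hac.symm hbc.symm hab
      rw [lie_add, add_eq_zero_iff_neg_eq] at this
      rw [← lie_skew, ← this, neg_neg]
      exact LieSubalgebra.lie_mem _ (ht a) (ht b)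
    by_cases hae : a = e
    · subst hae
      exact key a b hab hac hbc
    by_cases hbe : b = e
    · subst hbe
      rw [t_symm]
      exact key b a hab.symm hbc hac
    rw [t_quadruple k a b c e hab hce hac hae hbc hbe]
    exact zero_mem _
  -- The normalizer is a Lie subalgebra, so only generators `t_{ab}` need be tested; the Leibniz
  -- rule then reduces the second argument to generators as well.
  have hnorm : x ∈ (strand k c).range.normalizer := by
    refine mem_of_forall_t_mem _ (fun a b hab => ?_) x
    rw [LieSubalgebra.mem_normalizer_iff']
    rintro _ ⟨f, rfl⟩
    let S : LieSubalgebra k (FreeLieAlgebra k (Fin n)) :=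
      { (((strand k c).range.toSubmodule.comap
          (LieAlgebra.ad k (InfBraid k n) (t k a b) : Module.End k (InfBraid k n))).comap
          (strand k c : FreeLieAlgebra k (Fin n) →ₗ[k] InfBraid k n)) with
        lie_mem' := by
          intro f g hf hg
          change ⁅t k a b, strand k c f⁆ ∈ (strand k c).range at hf
          change ⁅t k a b, strand k c g⁆ ∈ (strand k c).range at hg
          change ⁅t k a b, strand k c ⁅f, g⁆⁆ ∈ (strand k c).range
          rw [LieHom.map_lie, leibniz_lie]
          exact add_mem (LieSubalgebra.lie_mem _ hf ⟨g, rfl⟩)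
            (LieSubalgebra.lie_mem _ ⟨f, rfl⟩ hg) }
    have hS : f ∈ S := by
      refine FreeLieAlgebra.mem_of_forall_of_mem S (fun e => ?_) f
      change ⁅t k a b, strand k c (FreeLieAlgebra.of k e)⁆ ∈ (strand k c).range
      rw [strand_of]
      exact hgen a b e hab
    rw [← lie_skew]
    exact neg_mem hS
  rw [← lie_skew]
  exact neg_mem <| (LieSubalgebra.mem_normalizer_iff' _ _).1 hnorm y hy

/-- `𝔱_{n+1}` is the sum of `𝔱_n` and of the ideal generated by the `t_{ca}`. -/
theorem sub_insertStrand_forgetStrand_mem (c : Fin (n + 1)) (x : InfBraid k (n + 1)) :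
    x - insertStrand k c (forgetStrand k c x) ∈ (strand k c).range := by
  let R : InfBraid k (n + 1) →ₗ[k] InfBraid k (n + 1) :=
    LinearMap.id - ((insertStrand k c).comp (forgetStrand k c) : _ →ₗ[k] _)
  let S : LieSubalgebra k (InfBraid k (n + 1)) :=
    { (strand k c).range.toSubmodule.comap R with
      lie_mem' := by
        intro x y hx hy
        change x - insertStrand k c (forgetStrand k c x) ∈ (strand k c).range at hx
        change y - insertStrand k c (forgetStrand k c y) ∈ (strand k c).range at hy
        change ⁅x, y⁆ - insertStrand k c (forgetStrand k c ⁅x, y⁆) ∈ (strand k c).range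
        have h1 := lie_mem_range_strand c (insertStrand k c (forgetStrand k c y)) _ hx
        have h2 := lie_mem_range_strand c x _ hy
        rw [LieHom.map_lie, LieHom.map_lie]
        -- With `p` for forgetting then reinserting: `[x, y] - [px, py] = [x, y - py] - [py, x -
        -- px]`, and both terms lie in the ideal.
        have : ⁅x, y⁆ - ⁅insertStrand k c (forgetStrand k c x),
            insertStrand k c (forgetStrand k c y)⁆ =
            ⁅x, y - insertStrand k c (forgetStrand k c y)⁆ -
            ⁅insertStrand k c (forgetStrand k c y),
              x - insertStrand k c (forgetStrand k c x)⁆ := by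
          rw [lie_sub, lie_sub, ← lie_skew (insertStrand k c (forgetStrand k c y)) x,
            ← lie_skew (insertStrand k c (forgetStrand k c y))
              (insertStrand k c (forgetStrand k c x))]
          abel
        rw [this]
        exact sub_mem h2 h1 }
  refine mem_of_forall_t_mem S (fun a b hab => ?_) x
  change t k a b - insertStrand k c (forgetStrand k c (t k a b)) ∈ (strand k c).range
  rcases Fin.eq_self_or_eq_succAbove c a with rfl | ⟨a, rfl⟩
  · rw [forgetStrand_t_self, map_zero, sub_zero]
    exact ⟨_, strand_of _ _⟩
  · rcases Fin.eq_self_or_eq_succAbove c b with rfl | ⟨b, rfl⟩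
    · rw [t_symm, forgetStrand_t_self, map_zero, sub_zero]
      exact ⟨_, strand_of _ _⟩
    · rw [forgetStrand_t_succAbove, insertStrand_t, sub_self]
      exact zero_mem _

/-! ### The merged subalgebra and the induction on the strands -/

/-- The Lie subalgebra of `𝔱_n` generated by the `t_{ab}` and `t_{ia} + t_{ja}` for
`a, b ≠ i, j`. -/
def mergedSubalgebra (k : Type*) [Field k] {n : ℕ} (i j : Fin n) : LieSubalgebra k (InfBraid k n) :=
  LieSubalgebra.lieSpan k _ {z | ∃ a, a ≠ i ∧ a ≠ j ∧
    ((∃ b, b ≠ i ∧ b ≠ j ∧ z = t k a b) ∨ z = t k i a + t k j a)}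

theorem t_mem_mergedSubalgebra {i j a b : Fin n} (hai : a ≠ i) (haj : a ≠ j) (hbi : b ≠ i)
    (hbj : b ≠ j) : t k a b ∈ mergedSubalgebra k i j :=
  LieSubalgebra.subset_lieSpan ⟨a, hai, haj, Or.inl ⟨b, hbi, hbj, rfl⟩⟩

theorem t_add_t_mem_mergedSubalgebra {i j a : Fin n} (hai : a ≠ i) (haj : a ≠ j) :
    t k i a + t k j a ∈ mergedSubalgebra k i j :=
  LieSubalgebra.subset_lieSpan ⟨a, hai, haj, Or.inr rfl⟩

theorem strand_mergeLieEnd_mem {c i j : Fin n} (hi : c ≠ i) (hj : c ≠ j)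
    (f : FreeLieAlgebra k (Fin n)) :
    strand k c (mergeLieEnd k i j f) ∈ mergedSubalgebra k i j := by
  refine FreeLieAlgebra.mem_of_forall_of_mem
    ((mergedSubalgebra k i j).comap ((strand k c).comp (mergeLieEnd k i j))) (fun a => ?_) f
  change strand k c (mergeLieEnd k i j (FreeLieAlgebra.of k a)) ∈ mergedSubalgebra k i j
  rw [mergeLieEnd, FreeLieAlgebra.lift_of_apply]
  split_ifs with hai haj
  · rw [map_zero]
    exact zero_mem _
  · rw [map_add, strand_of, strand_of, ← t_symm k c i, ← t_symm k c j]
    exact t_add_t_mem_mergedSubalgebra hi hj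
  -- This includes `a = c`: `t_{cc} = 0` is among the generators, since equal indices are allowed
  -- there.
  · rw [strand_of]
    exact t_mem_mergedSubalgebra hi hj hai haj

theorem insertStrand_mem_mergedSubalgebra (c : Fin (n + 1)) (i j : Fin n) {y : InfBraid k n}
    (hy : y ∈ mergedSubalgebra k i j) :
    insertStrand k c y ∈ mergedSubalgebra k (c.succAbove i) (c.succAbove j) := by
  have : mergedSubalgebra k i j ≤
      (mergedSubalgebra k (c.succAbove i) (c.succAbove j)).comap (insertStrand k c) := by
    refine LieSubalgebra.lieSpan_le.2 ?_
    rintro _ ⟨a, hai, haj, ⟨b, hbi, hbj, rfl⟩ | rfl⟩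
    · change insertStrand k c (t k a b) ∈ mergedSubalgebra k (c.succAbove i) (c.succAbove j)
      rw [insertStrand_t]
      exact t_mem_mergedSubalgebra (by simpa using hai) (by simpa using haj)
        (by simpa using hbi) (by simpa using hbj)
    · change insertStrand k c (t k i a + t k j a) ∈
        mergedSubalgebra k (c.succAbove i) (c.succAbove j)
      rw [map_add, insertStrand_t, insertStrand_t]
      exact t_add_t_mem_mergedSubalgebra (by simpa using hai) (by simpa using haj)
  exact this hy

/-- If there are no strands besides `i` and `j`, then `𝔱_n` is spanned by `t_{ij}`. -/
theorem exists_eq_smul_t {i j : Fin n} (h : ∀ c, c = i ∨ c = j) (x : InfBraid k n) :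
    ∃ r : k, x = r • t k i j := by
  let S : LieSubalgebra k (InfBraid k n) :=
    { Submodule.span k {t k i j} with
      lie_mem' := by
        intro x y hx hy
        obtain ⟨r, rfl⟩ := Submodule.mem_span_singleton.1 hx
        obtain ⟨s, rfl⟩ := Submodule.mem_span_singleton.1 hy
        rw [smul_lie, lie_smul, lie_self, smul_zero, smul_zero]
        exact zero_mem (Submodule.span k {t k i j}) }
  have hx : x ∈ S := by
    refine mem_of_forall_t_mem S (fun a b hab => ?_) x
    change t k a b ∈ Submodule.span k {t k i j}
    rcases h a with rfl | rfl <;> rcases h b with rfl | rfl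
    · exact absurd rfl hab
    · exact Submodule.mem_span_singleton_self _
    · rw [t_symm]
      exact Submodule.mem_span_singleton_self _
    · exact absurd rfl hab
  obtain ⟨r, hr⟩ := Submodule.mem_span_singleton.1 hx
  exact ⟨r, hr.symm⟩

/-- Induction on `n`, removing a strand `c` outside `{i, j}`; the scalar is carried over unchanged
from the smaller algebra. -/
theorem exists_sub_smul_t_mem_mergedSubalgebra [CharZero k] {i j : Fin n} (hij : i ≠ j)
    (x : InfBraid k n) (hx : ⁅x, t k i j⁆ = 0) :
    ∃ r : k, x - r • t k i j ∈ mergedSubalgebra k i j := by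
  induction n with
  | zero => exact i.elim0
  | succ n ih =>
    by_cases h : ∀ c, c = i ∨ c = j
    · obtain ⟨r, hr⟩ := exists_eq_smul_t h x
      refine ⟨r, ?_⟩
      rw [← hr, sub_self]
      exact zero_mem _
    push Not at h
    obtain ⟨c, hci, hcj⟩ := h
    obtain ⟨i, rfl⟩ := Fin.exists_succAbove_eq hci.symm
    obtain ⟨j, rfl⟩ := Fin.exists_succAbove_eq hcj.symm
    have hy : ⁅forgetStrand k c x, t k i j⁆ = 0 := by
      rw [← forgetStrand_t_succAbove c i j, ← LieHom.map_lie, hx, map_zero]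
    obtain ⟨r, hr⟩ := ih (fun h => hij (congrArg _ h)) _ hy
    have hr' := insertStrand_mem_mergedSubalgebra c i j hr
    rw [map_sub, map_smul, insertStrand_t] at hr'
    obtain ⟨f, hf⟩ := sub_insertStrand_forgetStrand_mem c x
    change strand k c f = _ at hf
    -- The ideal component is `x` minus its reinserted image, and both of these commute with
    -- `t_{ij}`.
    have hcomm : ⁅strand k c f, t k (c.succAbove i) (c.succAbove j)⁆ = 0 := by
      rw [hf, sub_lie, hx, ← insertStrand_t, ← LieHom.map_lie, hy, map_zero, sub_zero]
    obtain ⟨g, hg⟩ := exists_strand_mergeLieEnd hij hci.symm hcj.symm f hcomm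
    refine ⟨r, ?_⟩
    have hsum := add_mem (strand_mergeLieEnd_mem (k := k) hci hcj g) hr'
    rw [← hg, hf] at hsum
    convert hsum using 1
    abel

/-! ### Fibres of the merging map and the image of `merge` -/

theorem mergeMap_eq_zero_iff {i j : Fin n} (hij : i < j) (p : Fin n) :
    (mergeMap i j hij p).val = 0 ↔ p = i ∨ p = j := by
  have hij' : i.val < j.val := hij
  unfold mergeMap
  simp only [Fin.lt_def, Fin.ext_iff]
  split_ifs <;> (try simp only) <;> lia

/-- Position `0` is reserved for the merged strand. The ranges `p < i`, `i < p < j`, `j < p` are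
shifted by `1`, `0`, `-1` into the disjoint intervals `[1, i]`, `[i + 1, j - 1]`, `[j, n - 2]`. -/
theorem mergeMap_inj {i j : Fin n} (hij : i < j) {p q : Fin n} (hpi : p ≠ i) (hpj : p ≠ j)
    (h : mergeMap i j hij q = mergeMap i j hij p) : q = p := by
  have h' : (mergeMap i j hij q).val = (mergeMap i j hij p).val := congrArg Fin.val h
  have hij' : i.val < j.val := hij
  unfold mergeMap at h'
  simp only [Fin.lt_def, Fin.ext_iff, ne_eq] at hpi hpj h' ⊢
  split_ifs at h' <;> (try simp only at h') <;> omega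

theorem fibre_mergeMap {i j : Fin n} (hij : i < j) {p : Fin n} (hpi : p ≠ i) (hpj : p ≠ j) :
    fibre (fun q => some (mergeMap i j hij q)) (mergeMap i j hij p) = {p} := by
  ext q
  simp only [fibre, Finset.mem_filter, Finset.mem_univ, true_and, Option.some.injEq,
    Finset.mem_singleton]
  exact ⟨mergeMap_inj hij hpi hpj, fun h => by rw [h]⟩

theorem fibre_mergeMap_left {i j : Fin n} (hij : i < j) :
    fibre (fun q => some (mergeMap i j hij q)) (mergeMap i j hij i) = {i, j} := by
  ext q
  simp only [fibre, Finset.mem_filter, Finset.mem_univ, true_and, Option.some.injEq,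
    Finset.mem_insert, Finset.mem_singleton, Fin.ext_iff (a := mergeMap i j hij q),
    (mergeMap_eq_zero_iff hij i).2 (Or.inl rfl), mergeMap_eq_zero_iff]

/-- Each nonzero generator is the image of a single `t`: singleton fibres give `t_{ab}`, and the
fibre `{i, j}` gives `t_{ia} + t_{ja}`. -/
theorem mergedSubalgebra_le_range_merge {i j : Fin n} (hij : i < j) :
    mergedSubalgebra k i j ≤ (merge k i j hij).range := by
  refine LieSubalgebra.lieSpan_le.2 ?_
  rintro _ ⟨a, hai, haj, ⟨b, hbi, hbj, rfl⟩ | rfl⟩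
  · by_cases hab : a = b
    · subst hab
      rw [t_self]
      exact zero_mem _
    refine ⟨t k (mergeMap i j hij a) (mergeMap i j hij b), ?_⟩
    change merge k i j hij _ = _
    rw [merge, pullback_t _ _ _ _ fun h => hab (mergeMap_inj hij hbi hbj h),
      fibre_mergeMap hij hai haj, fibre_mergeMap hij hbi hbj]
    simp
  · refine ⟨t k (mergeMap i j hij i) (mergeMap i j hij a), ?_⟩
    change merge k i j hij _ = _
    rw [merge, pullback_t _ _ _ _ fun h => hai (mergeMap_inj hij hai haj h).symm,
      fibre_mergeMap hij hai haj, fibre_mergeMap_left, Finset.sum_pair hij.ne]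
    simp

end

end InfBraid

end

theorem propositionA1 (k : Type*) [Field k] [CharZero k] (n : ℕ) (i j : Fin n) (hij : i < j)
    (x : InfBraid k n) (hx : ⁅x, InfBraid.t k i j⁆ = 0) :
    ∃ (c : k) (y : InfBraid k (n - 1)),
      x = c • InfBraid.t k i j + InfBraid.merge k i j hij y := by
  obtain ⟨r, hr⟩ := InfBraid.exists_sub_smul_t_mem_mergedSubalgebra hij.ne x hx
  obtain ⟨y, hy⟩ := InfBraid.mergedSubalgebra_le_range_merge hij hr
  exact ⟨r, y, by rw [← sub_eq_iff_eq_add']; exact hy.symm⟩
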